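/- Let $M$ be a (Hausdorff, finite-dimensional, boundaryless) smooth manifold, let $n\ge 0$, and let $\mathcal T^n=TM\oplus\wedge^nT^*M$, equipped with the $\wedge^{n-1}T^*M$-valued symmetric pairing $$(X+\alpha,\,Y+\beta)=\tfrac12\,(i_X\beta+i_Y\alpha)$$ (which is zero for $n=0$) and with the higher-order Dorfman bracket on smooth sections $$\{X+\alpha,\,Y+\beta\}=[X,Y]+L_X\beta-L_Y\alpha+d\,i_Y\alpha .$$ Let $\omega\in\Omega^{n+1}(M)$ be a smooth $(n+1)$-form and let $$\mathcal G_\omega=\{X+i_X\omega : X\in TM\}\subset\mathcal T^n$$ be the graph of $\omega_\sharp:TM\to\wedge^nT^*M$, $X\mapsto i_X\omega$. Then: 1. $\mathcal G_\omega$ is a smooth subbundle of $\mathcal T^n$ which is isotropic (the pairing vanishes on each of its fibres). If $n\ge1$, it is maximal isotropic: each fibre of $\mathcal G_\omega$ is maximal among the isotropic linear subspaces of the corresponding fibre of $\mathcal T^n$. 2. The space of smooth sections of $\mathcal G_\omega$ is closed under the higher-order Dorfman bracket if and only if $d\omega=0$, i.e. if and only if $\omega$ is premultisymplectic. -/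

import Mathlib

open Bundle Set Topology VectorField
open scoped Manifold ContDiff Bundle

noncomputable section

namespace HigherDorfman

section Subbundle

variable (E : Type*) [NormedAddCommGroup E] [NormedSpace ℝ E]
  {M : Type*} [TopologicalSpace M] [ChartedSpace E M]
  (F : Type*) [NormedAddCommGroup F] [NormedSpace ℝ F]
  {V : M → Type*} [TopologicalSpace (TotalSpace F V)]
  [∀ x, AddCommGroup (V x)] [∀ x, Module ℝ (V x)] [∀ x, TopologicalSpace (V x)]
  [FiberBundle F V]

/-- Smoothness on a set `U` of a section `s` of a vector bundle `V` over the manifold `M`. -/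
def IsSmoothSectionOn (s : Π x : M, V x) (U : Set M) : Prop :=
  ContMDiffOn 𝓘(ℝ, E) (𝓘(ℝ, E).prod 𝓘(ℝ, F)) ∞ (fun x ↦ TotalSpace.mk' F x (s x)) U

/-- `s` is a (global) smooth section of the vector bundle `V` over the manifold `M`. -/
def IsSmoothSection (s : Π x : M, V x) : Prop :=
  ContMDiff 𝓘(ℝ, E) (𝓘(ℝ, E).prod 𝓘(ℝ, F)) ∞ (fun x ↦ TotalSpace.mk' F x (s x))

/-- A family `L` of linear subspaces of the fibres of `V` is a smooth subbundle (of some constant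
rank `k`) if around every point it is spanned by `k` smooth, pointwise linearly independent
local sections. -/
def IsSmoothSubbundle (L : Π x : M, Submodule ℝ (V x)) : Prop :=
  ∃ k : ℕ, ∀ x₀ : M, ∃ U : Set M, IsOpen U ∧ x₀ ∈ U ∧ ∃ s : Fin k → Π x : M, V x,
    (∀ i, IsSmoothSectionOn E F (s i) U) ∧
    ∀ x ∈ U, LinearIndependent ℝ (fun i ↦ s i x) ∧ Submodule.span ℝ (range fun i ↦ s i x) = L x

end Subbundle

variable {E : Type*} [NormedAddCommGroup E] [NormedSpace ℝ E]
  {M : Type*} [TopologicalSpace M] [ChartedSpace E M] [IsManifold 𝓘(ℝ, E) ∞ M]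

/-- The fibre at `x` of the bundle `Λⁿ T*M`: alternating `n`-linear forms on `T_x M`. -/
abbrev Form (E : Type*) [NormedAddCommGroup E] [NormedSpace ℝ E]
    {M : Type*} [TopologicalSpace M] [ChartedSpace E M] (n : ℕ) (x : M) : Type _ :=
  TangentSpace 𝓘(ℝ, E) x [⋀^Fin n]→L[ℝ] Bundle.Trivial M ℝ x

/-- The fibre at `x` of the bundle `𝒯ⁿ = TM ⊕ Λⁿ T*M`. -/
abbrev GenTangent (E : Type*) [NormedAddCommGroup E] [NormedSpace ℝ E]
    {M : Type*} [TopologicalSpace M] [ChartedSpace E M] (n : ℕ) : M → Type _ :=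
  (fun x : M ↦ TangentSpace 𝓘(ℝ, E) x) ×ᵇ (fun x : M ↦ Form E n x)

/-- `w` is a smooth differential `n`-form on `M`. -/
def IsSmoothForm {n : ℕ} (w : Π x : M, Form E n x) : Prop :=
  IsSmoothSection E (E [⋀^Fin n]→L[ℝ] ℝ) w

/-- The contraction `X ↦ i_X α` at a point, `(i_X α)(v₁, …, vₙ) = α(X, v₁, …, vₙ)`, for an
`(n+1)`-form `α`, as a linear map in `X`. -/
def contract {n : ℕ} {x : M} (α : Form E (n + 1) x) :
    TangentSpace 𝓘(ℝ, E) x →ₗ[ℝ] Form E n x :=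
  (ContinuousAlternatingMap.curryLeft (𝕜 := ℝ) (E := E) (F := ℝ) α).toLinearMap

/-- The exterior derivative on `M`. At `x`, it is computed on the coordinate representation of `w`
in the chart at `x`, and pulled back to `T_x M`. -/
def extD {n : ℕ} (w : Π x : M, Form E n x) (x : M) : Form E (n + 1) x :=
  (extDeriv (𝕜 := ℝ) (E := E) (F := ℝ)
      (fun y : E ↦ ContinuousAlternatingMap.compContinuousLinearMap
        (w ((extChartAt 𝓘(ℝ, E) x).symm y))
        (mfderiv 𝓘(ℝ, E) 𝓘(ℝ, E) (extChartAt 𝓘(ℝ, E) x).symm y))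
      (extChartAt 𝓘(ℝ, E) x x)).compContinuousLinearMap
    (mfderiv 𝓘(ℝ, E) 𝓘(ℝ, E) (extChartAt 𝓘(ℝ, E) x) x)

/-- The `n`-form `d i_Y α` for an `n`-form `α`. For `n = 0` one has `i_Y α = 0`. -/
def extDContract : {n : ℕ} → (Π x : M, TangentSpace 𝓘(ℝ, E) x) → (Π x : M, Form E n x) →
    Π x : M, Form E n x
  | 0, _, _ => fun _ ↦ 0
  | _ + 1, Y, α => extD fun x ↦ contract (α x) (Y x)

/-- The Lie derivative of forms, by Cartan's formula `L_X α = i_X dα + d i_X α`. -/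
def lieDeriv {n : ℕ} (X : Π x : M, TangentSpace 𝓘(ℝ, E) x) (α : Π x : M, Form E n x) (x : M) :
    Form E n x :=
  contract (extD α x) (X x) + extDContract X α x

/-- The `Λⁿ⁻¹ T*M`-valued pairing `⟨X + α, Y + β⟩ = ½ (i_X β + i_Y α)` on `𝒯ⁿ`. For `n = 0`, where
contractions vanish (`Λ⁻¹ T*M = 0`), it is zero. -/
def pairing : {n : ℕ} → {x : M} → GenTangent E n x → GenTangent E n x → Form E (n - 1) x
  | 0, _, _, _ => 0
  | n + 1, x, e₁, e₂ => (1 / 2 : ℝ) • ((contract e₂.2 e₁.1 + contract e₁.2 e₂.1 : Form E n x))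

/-- The higher-order Dorfman bracket
`{X + α, Y + β} = [X, Y] + L_X β - L_Y α + d i_Y α` of sections of `𝒯ⁿ`. -/
def dorfman {n : ℕ} (e₁ e₂ : Π x : M, GenTangent E n x) (x : M) : GenTangent E n x :=
  (mlieBracket 𝓘(ℝ, E) (fun y ↦ (e₁ y).1) (fun y ↦ (e₂ y).1) x,
    lieDeriv (fun y ↦ (e₁ y).1) (fun y ↦ (e₂ y).2) x
      - lieDeriv (fun y ↦ (e₂ y).1) (fun y ↦ (e₁ y).2) x
      + extDContract (fun y ↦ (e₂ y).1) (fun y ↦ (e₁ y).2) x)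

/-- The graph of `w_♯ : TM → Λⁿ T*M`, `X ↦ i_X w`, for an `(n+1)`-form `w`. -/
def formGraph {n : ℕ} (w : Π x : M, Form E (n + 1) x) (x : M) :
    Submodule ℝ (GenTangent E n x) :=
  (contract (w x)).graph

/-- A linear subspace of a fibre of `𝒯ⁿ` is isotropic if the pairing vanishes on it. -/
def IsIsotropic {n : ℕ} {x : M} (W : Submodule ℝ (GenTangent E n x)) : Prop :=
  ∀ u ∈ W, ∀ v ∈ W, pairing u v = 0

/-- `L` is an isotropic smooth subbundle of `𝒯ⁿ`. -/
def IsIsotropicSubbundle {n : ℕ} (L : Π x : M, Submodule ℝ (GenTangent E n x)) : Prop :=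
  IsSmoothSubbundle E (E × (E [⋀^Fin n]→L[ℝ] ℝ)) L ∧ ∀ x, IsIsotropic (L x)

/-- `L` is a smooth subbundle of `𝒯ⁿ`, each fibre of which is maximal among the isotropic linear
subspaces of the corresponding fibre of `𝒯ⁿ`. -/
def IsMaximalIsotropicSubbundle {n : ℕ} (L : Π x : M, Submodule ℝ (GenTangent E n x)) : Prop :=
  IsSmoothSubbundle E (E × (E [⋀^Fin n]→L[ℝ] ℝ)) L ∧ ∀ x, Maximal IsIsotropic (L x)

/-- The set of smooth sections of `L` is closed under the higher-order Dorfman bracket. -/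
def IsClosedUnderDorfman {n : ℕ} (L : Π x : M, Submodule ℝ (GenTangent E n x)) : Prop :=
  ∀ e₁ e₂ : Π x : M, GenTangent E n x,
    IsSmoothSection E (E × (E [⋀^Fin n]→L[ℝ] ℝ)) e₁ → IsSmoothSection E (E × (E [⋀^Fin n]→L[ℝ] ℝ)) e₂ →
    (∀ x, e₁ x ∈ L x) → (∀ x, e₂ x ∈ L x) → ∀ x, dorfman e₁ e₂ x ∈ L x

end HigherDorfman

end

/-! Isotropy is the antisymmetry of double contraction: `X + i_X ω` and `Y + i_Y ω` pair to `½ (i_X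
i_Y ω + i_Y i_X ω) = 0`. For `n ≥ 1`, if `v + b` is orthogonal to the whole graph, then `b - i_v ω`
is killed by every contraction, hence zero, which gives maximality. For the bracket, everything
rests on `{X + i_X ω, Y + i_Y ω} = [X, Y] + i_[X,Y] ω + i_Y i_X dω` (`dorfman_graph`). Closure thus
means that `i_Y i_X dω = 0` for all smooth `X`, `Y`; since tangent vectors extend to global fields,
this is `dω = 0`. The identity is pointwise, so it is checked at `x` in the chart at `x`, where it
becomes Cartan calculus on a vector space (`extDeriv_interiorProd_bracket`). -/

noncomputable section

/-! ### Contraction and alternatization -/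

namespace ContinuousAlternatingMap

variable {E : Type*} [NormedAddCommGroup E] [NormedSpace ℝ E] {n : ℕ}

/-- Contraction of an alternating form with a fixed vector, as a continuous linear map. -/
def interiorProd (u : E) : (E [⋀^Fin (n + 1)]→L[ℝ] ℝ) →L[ℝ] (E [⋀^Fin n]→L[ℝ] ℝ) :=
  (ContinuousLinearMap.apply ℝ _ u) ∘L
    (curryLeftLI (𝕜 := ℝ) (E := E) (F := ℝ) (n := n)).toContinuousLinearMap

theorem interiorProd_apply (u : E) (α : E [⋀^Fin (n + 1)]→L[ℝ] ℝ) :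
    interiorProd u α = α.curryLeft u := rfl

/-- Polarization of `i_u i_u α = 0` at `u + v`. -/
theorem interiorProd_interiorProd_swap (u v : E) (α : E [⋀^Fin (n + 2)]→L[ℝ] ℝ) :
    interiorProd u (interiorProd v α) = -interiorProd v (interiorProd u α) := by
  have h := curryLeft_same α (u + v)
  have hu := curryLeft_same α u
  have hv := curryLeft_same α v
  simp only [map_add, curryLeft_add, hu, hv, _root_.add_apply] at h
  simp only [interiorProd_apply]
  rw [eq_neg_iff_add_eq_zero]
  simpa [add_comm] using h

/-- Contraction with the first slot of the alternatization of a linear map valued in forms of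
positive degree. -/
theorem interiorProd_alternatizeUncurryFin (A : E →L[ℝ] (E [⋀^Fin (n + 1)]→L[ℝ] ℝ)) (u : E) :
    interiorProd u (alternatizeUncurryFin A) = A u - alternatizeUncurryFin (interiorProd u ∘L A) := by
  ext v
  simp only [interiorProd_apply, curryLeft_apply_apply, alternatizeUncurryFin_apply, sub_apply,
    Fin.sum_univ_succ (n := n + 1), ContinuousLinearMap.comp_apply]
  rw [sub_eq_add_neg, ← Finset.sum_neg_distrib]
  congr 1
  · simp
  · refine Finset.sum_congr rfl fun i _ ↦ ?_
    -- Deleting a later slot leaves `u` in front; the index shift produces the minus sign.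
    have : i.succ.removeNth (Matrix.vecCons u v) = Matrix.vecCons u (i.removeNth v) := by
      ext j
      cases j using Fin.cases <;> simp [Fin.removeNth]
    rw [this]
    simp [pow_succ]

/-- The correction term drops out, as 0-forms have no contraction; hence the separate one-form case
of the Cartan identity. -/
theorem interiorProd_alternatizeUncurryFin_zero (A : E →L[ℝ] (E [⋀^Fin 0]→L[ℝ] ℝ)) (u : E) :
    interiorProd u (alternatizeUncurryFin A) = A u := by
  ext v
  simp [interiorProd_apply, alternatizeUncurryFin_apply]

end ContinuousAlternatingMap

/-! ### Cartan calculus on a vector space -/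

section Cartan

open ContinuousAlternatingMap

variable {E : Type*} [NormedAddCommGroup E] [NormedSpace ℝ E] {n : ℕ}

/-- Product rule for the bilinear contraction; the terms in `DX` and `DY` later assemble into the
Lie bracket. -/
theorem hasFDerivAt_interiorProd {η : E → E [⋀^Fin (n + 1)]→L[ℝ] ℝ} {X : E → E} {x : E}
    (hη : DifferentiableAt ℝ η x) (hX : DifferentiableAt ℝ X x) :
    HasFDerivAt (fun y ↦ (η y).curryLeft (X y))
      (interiorProd (X x) ∘L fderiv ℝ η x + (η x).curryLeft ∘L fderiv ℝ X x) x := by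
  have h1 : HasFDerivAt (fun y ↦ (η y).curryLeft)
      ((curryLeftLI (𝕜 := ℝ) (E := E) (F := ℝ) (n := n)).toContinuousLinearMap ∘L fderiv ℝ η x) x :=
    HasFDerivAt.comp (g := (curryLeftLI (𝕜 := ℝ) (E := E) (F := ℝ) (n := n)).toContinuousLinearMap)
      x (ContinuousLinearMap.hasFDerivAt _) hη.hasFDerivAt
  refine (h1.clm_apply hX.hasFDerivAt).congr_fderiv ?_
  ext v
  simp [interiorProd_apply, add_comm]

/-- Cartan calculus for one-forms: `ι_X d ι_Y η - ι_Y d ι_X η = ι_[X,Y] η + ι_Y ι_X dη`. -/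
theorem extDeriv_interiorProd_bracket_one {η : E → E [⋀^Fin 1]→L[ℝ] ℝ} {X Y : E → E} {x : E}
    (hη : DifferentiableAt ℝ η x) (hX : DifferentiableAt ℝ X x) (hY : DifferentiableAt ℝ Y x) :
    (extDeriv (fun y ↦ (η y).curryLeft (Y y)) x).curryLeft (X x)
      - (extDeriv (fun y ↦ (η y).curryLeft (X y)) x).curryLeft (Y x)
      = (η x).curryLeft (lieBracket ℝ X Y x) + ((extDeriv η x).curryLeft (X x)).curryLeft (Y x) := by
  simp only [extDeriv, (hasFDerivAt_interiorProd hη hX).fderiv,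
    (hasFDerivAt_interiorProd hη hY).fderiv]
  simp only [← interiorProd_apply (X x), ← interiorProd_apply (Y x),
    interiorProd_alternatizeUncurryFin, interiorProd_alternatizeUncurryFin_zero, map_sub,
    lieBracket, _root_.add_apply, ContinuousLinearMap.comp_apply]
  abel

/-- Cartan calculus:
`ι_X d ι_Y η + d ι_X ι_Y η - ι_Y d ι_X η = ι_[X,Y] η + ι_Y ι_X dη`. -/
theorem extDeriv_interiorProd_bracket {η : E → E [⋀^Fin (n + 2)]→L[ℝ] ℝ} {X Y : E → E} {x : E}
    (hη : DifferentiableAt ℝ η x) (hX : DifferentiableAt ℝ X x) (hY : DifferentiableAt ℝ Y x) :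
    (extDeriv (fun y ↦ (η y).curryLeft (Y y)) x).curryLeft (X x)
      + extDeriv (fun y ↦ ((η y).curryLeft (Y y)).curryLeft (X y)) x
      - (extDeriv (fun y ↦ (η y).curryLeft (X y)) x).curryLeft (Y x)
      = (η x).curryLeft (lieBracket ℝ X Y x) + ((extDeriv η x).curryLeft (X x)).curryLeft (Y x) := by
  have hYη := hasFDerivAt_interiorProd hη hY
  have hXYη := hasFDerivAt_interiorProd hYη.differentiableAt hX
  -- With this sign, the `DX` term of `d ι_X ι_Y η` cancels the one in `ι_Y d ι_X η`.
  have key : ((η x).curryLeft (Y x)).curryLeft ∘L fderiv ℝ X x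
      = -(interiorProd (Y x) ∘L (η x).curryLeft ∘L fderiv ℝ X x) := by
    ext1 v
    exact interiorProd_interiorProd_swap _ _ _
  have alt_neg (A : E →L[ℝ] (E [⋀^Fin n]→L[ℝ] ℝ)) :
      alternatizeUncurryFin (-A) = -alternatizeUncurryFin A :=
    map_neg (alternatizeUncurryFinCLM ℝ E ℝ) A
  simp only [extDeriv, hXYη.fderiv, key]
  simp only [hYη.fderiv, (hasFDerivAt_interiorProd hη hX).fderiv]
  simp only [← interiorProd_apply (X x), ← interiorProd_apply (Y x),
    interiorProd_alternatizeUncurryFin, map_sub, lieBracket]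
  simp only [_root_.add_apply, ContinuousLinearMap.comp_apply, ContinuousLinearMap.comp_add,
    alternatizeUncurryFin_add, alt_neg]
  simp only [interiorProd_apply]
  abel

end Cartan

namespace HigherDorfman

variable {E : Type*} [NormedAddCommGroup E] [NormedSpace ℝ E]
  {M : Type*} [TopologicalSpace M] [ChartedSpace E M] {n : ℕ}

/-! ### Linear algebra of the fibres -/

theorem contract_antisymm {x : M} (α : Form E (n + 2) x) (u v : TangentSpace 𝓘(ℝ, E) x) :
    contract (contract α u) v + contract (contract α v) u = 0 :=
  eq_neg_iff_add_eq_zero.1 (ContinuousAlternatingMap.interiorProd_interiorProd_swap (E := E) v u α)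

theorem eq_zero_of_contract {x : M} {α : Form E (n + 1) x} (h : ∀ u, contract α u = 0) :
    α = 0 := by
  ext v
  have := DFunLike.congr_fun (h (v 0)) (Fin.tail v)
  refine Eq.trans (congr_arg α ?_) this
  exact (Fin.cons_self_tail v).symm

theorem isIsotropic_formGraph (w : Π x : M, Form E (n + 1) x) (x : M) :
    IsIsotropic (formGraph w x) := by
  rintro ⟨u, a⟩ hu ⟨v, b⟩ hv
  obtain rfl : a = contract (w x) u := hu
  obtain rfl : b = contract (w x) v := hv
  cases n with
  | zero => rfl
  | succ n =>
    change (1 / 2 : ℝ) • (contract (contract (w x) v) u + contract (contract (w x) u) v) = 0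
    rw [contract_antisymm, smul_zero]

/-- Any element of a larger isotropic `W` is tested against the graph vectors `u + i_u w`, which
already determine its form part because that form has positive degree. -/
theorem maximal_formGraph (w : Π x : M, Form E (n + 2) x) (x : M) :
    Maximal IsIsotropic (formGraph w x) := by
  refine ⟨isIsotropic_formGraph w x, fun W hW hle ↦ ?_⟩
  rintro ⟨v, b⟩ hv
  change b = contract (w x) v
  rw [← sub_eq_zero]
  refine eq_zero_of_contract fun u ↦ ?_
  have h : (1 / 2 : ℝ) • (contract b u + contract (contract (w x) u) v) = 0 :=
    hW (u, contract (w x) u) (hle rfl) (v, b) hv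
  have h' := (smul_eq_zero.1 h).resolve_left (by norm_num)
  have h'' := contract_antisymm (w x) u v
  have e : contract (b - contract (w x) v) u = contract b u - contract (contract (w x) v) u := rfl
  rw [e, eq_neg_of_add_eq_zero_left h', eq_neg_of_add_eq_zero_right h'', sub_self]

/-! ### Passage to the chart at a point -/

theorem eventually_symm_mem_source (x : M) : ∀ᶠ z in 𝓝 (extChartAt 𝓘(ℝ, E) x x),
    (extChartAt 𝓘(ℝ, E) x).symm z ∈ (chartAt E x).source := by
  filter_upwards [extChartAt_target_mem_nhds (I := 𝓘(ℝ, E)) x] with z hz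
  simpa using (extChartAt 𝓘(ℝ, E) x).map_target hz

variable [IsManifold 𝓘(ℝ, E) ∞ M]

/-- The coordinate representation of a vector field in the trivialization at `x₀`. -/
def vecRep (x₀ : M) (X : Π x : M, TangentSpace 𝓘(ℝ, E) x) (x : M) : E :=
  (trivializationAt E (TangentSpace 𝓘(ℝ, E)) x₀ ⟨x, X x⟩).2

/-- The coordinate representation of a differential form in the trivialization at `x₀`. -/
def formRep (x₀ : M) (α : Π x : M, Form E n x) (x : M) : E [⋀^Fin n]→L[ℝ] ℝ :=
  (trivializationAt (E [⋀^Fin n]→L[ℝ] ℝ) (fun x : M ↦ Form E n x) x₀ ⟨x, α x⟩).2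

theorem formRep_eq (x₀ : M) (α : Π x : M, Form E n x) (x : M) :
    formRep x₀ α x = ContinuousAlternatingMap.compContinuousLinearMap (α x)
      ((trivializationAt E (TangentSpace 𝓘(ℝ, E)) x₀).symmL ℝ x) := by
  ext v
  simp [formRep, FiberBundle.trivializationAt_continuousAlternatingMap_apply,
    ContinuousAlternatingMap.inCoordinates]

theorem symmL_vecRep {x₀ x : M} (hx : x ∈ (chartAt E x₀).source)
    (X : Π x : M, TangentSpace 𝓘(ℝ, E) x) :
    (trivializationAt E (TangentSpace 𝓘(ℝ, E)) x₀).symmL ℝ x (vecRep x₀ X x) = X x := by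
  have hb : x ∈ (trivializationAt E (TangentSpace 𝓘(ℝ, E)) x₀).baseSet := by simpa using hx
  rw [Trivialization.symmL_apply (hb := hb)]
  exact Trivialization.symm_apply_apply_mk _ hb (X x)

theorem formRep_contract {x₀ x : M} (hx : x ∈ (chartAt E x₀).source)
    (X : Π x : M, TangentSpace 𝓘(ℝ, E) x) (α : Π x : M, Form E (n + 1) x) :
    formRep x₀ (fun y ↦ contract (α y) (X y)) x = (formRep x₀ α x).curryLeft (vecRep x₀ X x) := by
  rw [formRep_eq, formRep_eq]
  ext v
  refine congr_arg (α x) (funext fun i ↦ ?_)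
  cases i using Fin.cases with
  | zero => exact (symmL_vecRep hx X).symm
  | succ i => rfl

theorem contMDiffAt_vectorField_iff {X : Π x : M, TangentSpace 𝓘(ℝ, E) x} {x : M} :
    ContMDiffAt 𝓘(ℝ, E) (𝓘(ℝ, E).prod 𝓘(ℝ, E)) ∞ (fun x ↦ TotalSpace.mk' E x (X x)) x ↔
      ContMDiffAt 𝓘(ℝ, E) 𝓘(ℝ, E) ∞ (vecRep x X) x :=
  contMDiffAt_section x

theorem contMDiffAt_form_iff {α : Π x : M, Form E n x} {x : M} :
    ContMDiffAt 𝓘(ℝ, E) (𝓘(ℝ, E).prod 𝓘(ℝ, E [⋀^Fin n]→L[ℝ] ℝ)) ∞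
      (fun x ↦ TotalSpace.mk' (E [⋀^Fin n]→L[ℝ] ℝ) x (α x)) x ↔
      ContMDiffAt 𝓘(ℝ, E) 𝓘(ℝ, E [⋀^Fin n]→L[ℝ] ℝ) ∞ (formRep x α) x :=
  contMDiffAt_section x

theorem contMDiffAt_genTangent_iff {e : Π x : M, GenTangent E n x} {x : M} :
    ContMDiffAt 𝓘(ℝ, E) (𝓘(ℝ, E).prod 𝓘(ℝ, E × (E [⋀^Fin n]→L[ℝ] ℝ))) ∞
      (fun x ↦ TotalSpace.mk' (E × (E [⋀^Fin n]→L[ℝ] ℝ)) x (e x)) x ↔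
      ContMDiffAt 𝓘(ℝ, E) 𝓘(ℝ, E) ∞ (vecRep x fun y ↦ (e y).1) x ∧
      ContMDiffAt 𝓘(ℝ, E) 𝓘(ℝ, E [⋀^Fin n]→L[ℝ] ℝ) ∞ (formRep x fun y ↦ (e y).2) x := by
  refine (contMDiffAt_section x).trans ?_
  exact contMDiffAt_prod_module_iff _

theorem contMDiffAt_formRep_contract {x : M} {X : Π x : M, TangentSpace 𝓘(ℝ, E) x}
    {α : Π x : M, Form E (n + 1) x}
    (hX : ContMDiffAt 𝓘(ℝ, E) 𝓘(ℝ, E) ∞ (vecRep x X) x)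
    (hα : ContMDiffAt 𝓘(ℝ, E) 𝓘(ℝ, E [⋀^Fin (n + 1)]→L[ℝ] ℝ) ∞ (formRep x α) x) :
    ContMDiffAt 𝓘(ℝ, E) 𝓘(ℝ, E [⋀^Fin n]→L[ℝ] ℝ) ∞
      (formRep x fun y ↦ contract (α y) (X y)) x := by
  have h1 : ContMDiffAt 𝓘(ℝ, E) 𝓘(ℝ, E →L[ℝ] E [⋀^Fin n]→L[ℝ] ℝ) ∞
      (fun y ↦ (formRep x α y).curryLeft) x :=
    ContMDiffAt.comp (g := (ContinuousAlternatingMap.curryLeftLI (𝕜 := ℝ) (E := E) (F := ℝ)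
      (n := n)).toContinuousLinearMap) x (ContinuousLinearMap.contMDiff _).contMDiffAt hα
  refine (h1.clm_apply hX).congr_of_eventuallyEq ?_
  filter_upwards [(chartAt E x).open_source.mem_nhds (mem_chart_source E x)] with y hy
  exact formRep_contract hy X α

/-- The graph section `X + i_X w` is smooth at `x` as soon as `X` and `w` are. -/
theorem contMDiffAt_graph_section {x : M} {X : Π x : M, TangentSpace 𝓘(ℝ, E) x}
    {w : Π x : M, Form E (n + 1) x} (hw : IsSmoothForm w)
    (hX : ContMDiffAt 𝓘(ℝ, E) (𝓘(ℝ, E).prod 𝓘(ℝ, E)) ∞ (fun x ↦ TotalSpace.mk' E x (X x)) x) :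
    ContMDiffAt 𝓘(ℝ, E) (𝓘(ℝ, E).prod 𝓘(ℝ, E × (E [⋀^Fin n]→L[ℝ] ℝ))) ∞
      (fun x ↦ TotalSpace.mk' (E := GenTangent E n) (E × (E [⋀^Fin n]→L[ℝ] ℝ)) x
        (X x, contract (w x) (X x))) x :=
  contMDiffAt_genTangent_iff.2 ⟨contMDiffAt_vectorField_iff.1 hX,
    contMDiffAt_formRep_contract (contMDiffAt_vectorField_iff.1 hX) (contMDiffAt_form_iff.1 (hw x))⟩

/-- Links the trivializations that define smoothness to the chart derivatives that define `extD`. -/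
theorem symmL_eq_mfderiv {x₀ : M} {z : E} (hz : z ∈ (extChartAt 𝓘(ℝ, E) x₀).target) :
    (trivializationAt E (TangentSpace 𝓘(ℝ, E)) x₀).symmL ℝ ((extChartAt 𝓘(ℝ, E) x₀).symm z) =
      mfderiv 𝓘(ℝ, E) 𝓘(ℝ, E) (extChartAt 𝓘(ℝ, E) x₀).symm z := by
  have : IsManifold 𝓘(ℝ, E) 1 M := .of_le (n := ∞) (by simp)
  have hx : (extChartAt 𝓘(ℝ, E) x₀).symm z ∈ (chartAt E x₀).source := by
    simpa using (extChartAt 𝓘(ℝ, E) x₀).map_target hz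
  rw [TangentBundle.symmL_trivializationAt hx, (extChartAt 𝓘(ℝ, E) x₀).right_inv hz,
    ModelWithCorners.range_eq_univ, mfderivWithin_univ]

/-- The chart at `x` has identity derivative at `x`, so the outer pullback disappears. -/
theorem extD_eq (w : Π x : M, Form E n x) (x : M) :
    extD w x = extDeriv (fun z : E ↦ formRep x w ((extChartAt 𝓘(ℝ, E) x).symm z))
      (extChartAt 𝓘(ℝ, E) x x) := by
  have : IsManifold 𝓘(ℝ, E) 1 M := .of_le (n := ∞) (by simp)
  rw [extD, mfderiv_extChartAt_self]
  have : (fun y : E ↦ ContinuousAlternatingMap.compContinuousLinearMap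
        (w ((extChartAt 𝓘(ℝ, E) x).symm y))
        (mfderiv 𝓘(ℝ, E) 𝓘(ℝ, E) (extChartAt 𝓘(ℝ, E) x).symm y)) =ᶠ[𝓝 (extChartAt 𝓘(ℝ, E) x x)]
      fun z : E ↦ formRep x w ((extChartAt 𝓘(ℝ, E) x).symm z) := by
    filter_upwards [extChartAt_target_mem_nhds x] with z hz
    rw [formRep_eq, symmL_eq_mfderiv hz]
  rw [this.extDeriv_eq]
  rfl

theorem extD_contract_eq (X : Π x : M, TangentSpace 𝓘(ℝ, E) x) (α : Π x : M, Form E (n + 1) x)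
    (x : M) :
    extD (fun y ↦ contract (α y) (X y)) x =
      extDeriv (fun z : E ↦ (formRep x α ((extChartAt 𝓘(ℝ, E) x).symm z)).curryLeft
        (vecRep x X ((extChartAt 𝓘(ℝ, E) x).symm z))) (extChartAt 𝓘(ℝ, E) x x) := by
  rw [extD_eq]
  refine Filter.EventuallyEq.extDeriv_eq ?_
  filter_upwards [eventually_symm_mem_source x] with z hz
  exact formRep_contract hz X α

theorem mlieBracket_eq (X Y : Π x : M, TangentSpace 𝓘(ℝ, E) x) (x : M) :
    mlieBracket 𝓘(ℝ, E) X Y x =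
      lieBracket ℝ (fun z ↦ vecRep x X ((extChartAt 𝓘(ℝ, E) x).symm z))
        (fun z ↦ vecRep x Y ((extChartAt 𝓘(ℝ, E) x).symm z)) (extChartAt 𝓘(ℝ, E) x x) := by
  have : IsManifold 𝓘(ℝ, E) 1 M := .of_le (n := ∞) (by simp)
  -- The bracket depends only on germs, so agreement near the centre of the chart suffices.
  have h (V : Π x : M, TangentSpace 𝓘(ℝ, E) x) :
      mpullbackWithin 𝓘(ℝ, E) 𝓘(ℝ, E) (extChartAt 𝓘(ℝ, E) x).symm V univ
        =ᶠ[𝓝 (extChartAt 𝓘(ℝ, E) x x)]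
      fun z ↦ vecRep x V ((extChartAt 𝓘(ℝ, E) x).symm z) := by
    filter_upwards [eventually_symm_mem_source x, extChartAt_target_mem_nhds (I := 𝓘(ℝ, E)) x]
      with z hz hz'
    have hinv := isInvertible_mfderivWithin_extChartAt_symm (I := 𝓘(ℝ, E)) hz'
    rw [ModelWithCorners.range_eq_univ] at hinv
    refine hinv.inverse_apply_eq.2 ?_
    rw [mfderivWithin_univ, ← symmL_eq_mfderiv hz']
    exact (symmL_vecRep hz V).symm
  rw [← mlieBracketWithin_univ, mlieBracketWithin_apply, mfderiv_extChartAt_self]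
  have hr : range 𝓘(ℝ, E) = univ := ModelWithCorners.range_eq_univ _
  refine (DFunLike.congr_fun (ContinuousLinearMap.inverse_id (R := ℝ) (M := E)) _).trans ?_
  rw [preimage_univ, univ_inter, hr]
  exact (congrFun (lieBracketWithin_univ ..) _).trans ((h X).lieBracket_vectorField_eq (h Y))

theorem differentiableAt_comp_extChartAt_symm {F : Type*} [NormedAddCommGroup F] [NormedSpace ℝ F]
    {f : M → F} {x : M} (hf : ContMDiffAt 𝓘(ℝ, E) 𝓘(ℝ, F) ∞ f x) :
    DifferentiableAt ℝ (fun z ↦ f ((extChartAt 𝓘(ℝ, E) x).symm z)) (extChartAt 𝓘(ℝ, E) x x) := by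
  have h1 : ContMDiffAt 𝓘(ℝ, E) 𝓘(ℝ, E) ∞ (extChartAt 𝓘(ℝ, E) x).symm
      (extChartAt 𝓘(ℝ, E) x x) :=
    (contMDiffOn_extChartAt_symm x).contMDiffAt (extChartAt_target_mem_nhds x)
  have h2 := hf.comp_of_eq h1 (extChartAt_to_inv x)
  exact (contMDiffAt_iff_contDiffAt.1 h2).differentiableAt (by simp)

theorem formRep_self (α : Π x : M, Form E n x) (x : M) : formRep x α x = α x := by
  have : IsManifold 𝓘(ℝ, E) 1 M := .of_le (n := ∞) (by simp)
  rw [formRep_eq, TangentBundle.symmL_trivializationAt_eq_core (mem_chart_source E x)]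
  ext v
  refine congr_arg (α x) (funext fun i ↦ ?_)
  exact (tangentBundleCore 𝓘(ℝ, E) M).coordChange_self (achart E x) x (mem_chart_source E x) (v i)

theorem vecRep_self (X : Π x : M, TangentSpace 𝓘(ℝ, E) x) (x : M) : vecRep x X x = X x := by
  have : IsManifold 𝓘(ℝ, E) 1 M := .of_le (n := ∞) (by simp)
  have h := symmL_vecRep (mem_chart_source E x) X
  rw [TangentBundle.symmL_trivializationAt_eq_core (mem_chart_source E x)] at h
  exact ((tangentBundleCore 𝓘(ℝ, E) M).coordChange_self (achart E x) x (mem_chart_source E x)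
    _).symm.trans h

/-! ### Bracket, extension of vectors and the three claims -/

/-- On sections of the graph of `w`, the Dorfman bracket deviates from the graph by `i_Y i_X dw`. -/
theorem dorfman_graph {w : Π x : M, Form E (n + 1) x} {X Y : Π x : M, TangentSpace 𝓘(ℝ, E) x}
    {x : M} (hw : ContMDiffAt 𝓘(ℝ, E) 𝓘(ℝ, E [⋀^Fin (n + 1)]→L[ℝ] ℝ) ∞ (formRep x w) x)
    (hX : ContMDiffAt 𝓘(ℝ, E) 𝓘(ℝ, E) ∞ (vecRep x X) x)
    (hY : ContMDiffAt 𝓘(ℝ, E) 𝓘(ℝ, E) ∞ (vecRep x Y) x) :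
    dorfman (fun y ↦ (X y, contract (w y) (X y))) (fun y ↦ (Y y, contract (w y) (Y y))) x =
      (mlieBracket 𝓘(ℝ, E) X Y x, contract (w x) (mlieBracket 𝓘(ℝ, E) X Y x)
        + contract (contract (extD w x) (X x)) (Y x)) := by
  refine Prod.ext rfl ?_
  have dw := differentiableAt_comp_extChartAt_symm hw
  have dX := differentiableAt_comp_extChartAt_symm hX
  have dY := differentiableAt_comp_extChartAt_symm hY
  have hto : (extChartAt 𝓘(ℝ, E) x).symm (extChartAt 𝓘(ℝ, E) x x) = x := extChartAt_to_inv x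
  rw [mlieBracket_eq, extD_eq w]
  cases n with
  | zero =>
    have key := extDeriv_interiorProd_bracket_one dw dX dY
    simp only [hto, formRep_self, vecRep_self] at key
    refine Eq.trans ?_ key
    simp only [dorfman, lieDeriv, extDContract, extD_contract_eq]
    simp
    rfl
  | succ n =>
    have key := extDeriv_interiorProd_bracket dw dX dY
    simp only [hto, formRep_self, vecRep_self] at key
    refine Eq.trans ?_ key
    have hc : extD (fun y ↦ contract (contract (w y) (Y y)) (X y)) x =
        extDeriv (fun z : E ↦ ((formRep x w ((extChartAt 𝓘(ℝ, E) x).symm z)).curryLeft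
          (vecRep x Y ((extChartAt 𝓘(ℝ, E) x).symm z))).curryLeft
          (vecRep x X ((extChartAt 𝓘(ℝ, E) x).symm z))) (extChartAt 𝓘(ℝ, E) x x) := by
      rw [extD_contract_eq X (fun y ↦ contract (w y) (Y y))]
      refine Filter.EventuallyEq.extDeriv_eq ?_
      filter_upwards [eventually_symm_mem_source x] with z hz
      rw [formRep_contract hz Y w]
    rw [← hc]
    simp only [dorfman, lieDeriv, extDContract]
    -- The last bracket term `d i_Y i_X w` cancels the exact part of `L_Y i_X w`.
    rw [extD_contract_eq X w, extD_contract_eq Y w, add_sub_assoc, add_assoc, sub_add_eq_sub_sub,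
      sub_add_cancel]
    exact (add_sub_assoc _ _ _).symm

/-- Every tangent vector extends to a global smooth vector field. -/
theorem exists_smooth_extension [FiniteDimensional ℝ E] [T2Space M] {x : M}
    (u : TangentSpace 𝓘(ℝ, E) x) : ∃ X : Π x : M, TangentSpace 𝓘(ℝ, E) x,
      IsSmoothSection E E X ∧ X x = u := by
  obtain ⟨s, hs, h⟩ := FiberBundle.exists_contMDiffOn_extend (I := 𝓘(ℝ, E)) (k := ∞) E u
  obtain ⟨t, hts, ht, hxt⟩ := mem_nhds_iff.1 hs
  -- A bump function supported where the local extension is smooth makes the product globally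
  -- smooth.
  obtain ⟨f, -, hf⟩ := (SmoothBumpFunction.nhds_basis_tsupport (I := 𝓘(ℝ, E)) x).mem_iff.1
    (ht.mem_nhds hxt)
  refine ⟨fun y ↦ f y • FiberBundle.extend E u y, ?_, by simp⟩
  exact ContMDiffOn.smul_section_of_tsupport f.contMDiff.contMDiffOn ht hf (h.mono hts)

/-- `X ↦ X + i_X w` carries a local frame of `TM` to a frame of the graph; projecting back to `TM`
shows independence. -/
theorem isSmoothSubbundle_formGraph [FiniteDimensional ℝ E] {w : Π x : M, Form E (n + 1) x}
    (hw : IsSmoothForm w) :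
    IsSmoothSubbundle E (E × (E [⋀^Fin n]→L[ℝ] ℝ)) (V := GenTangent E n) (formGraph w) := by
  refine ⟨Module.finrank ℝ E, fun x₀ ↦ ?_⟩
  set e := trivializationAt E (TangentSpace 𝓘(ℝ, E) : M → Type _) x₀
  set b := Module.finBasis ℝ E
  have hfr := e.isLocalFrameOn_localFrame_baseSet 𝓘(ℝ, E) ∞ b
  refine ⟨e.baseSet, e.open_baseSet, FiberBundle.mem_baseSet_trivializationAt' x₀,
    fun i x ↦ (e.localFrame b i x, contract (w x) (e.localFrame b i x)), fun i x hx ↦ ?_,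
    fun x hx ↦ ⟨?_, ?_⟩⟩
  · exact (contMDiffAt_graph_section hw (hfr.contMDiffAt e.open_baseSet hx i)).contMDiffWithinAt
  · exact LinearIndependent.of_comp (LinearMap.fst ℝ _ _) (hfr.linearIndependent hx)
  · have hspan : Submodule.span ℝ (range fun i ↦ e.localFrame b i x) = ⊤ :=
      top_le_iff.1 (hfr.generating hx)
    rw [formGraph, LinearMap.graph_eq_range_prod, LinearMap.range_eq_map, ← hspan,
      Submodule.map_span, ← range_comp]
    rfl

theorem isClosedUnderDorfman_formGraph_iff [FiniteDimensional ℝ E] [T2Space M]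
    {w : Π x : M, Form E (n + 1) x} (hw : IsSmoothForm w) :
    IsClosedUnderDorfman (formGraph w) ↔ ∀ x, extD w x = 0 := by
  constructor
  · intro h x
    refine eq_zero_of_contract fun u ↦ eq_zero_of_contract fun v ↦ ?_
    obtain ⟨X, hX, rfl⟩ := exists_smooth_extension u
    obtain ⟨Y, hY, rfl⟩ := exists_smooth_extension v
    have hm := h (fun y ↦ (X y, contract (w y) (X y))) (fun y ↦ (Y y, contract (w y) (Y y)))
      (fun y ↦ contMDiffAt_graph_section hw (hX y)) (fun y ↦ contMDiffAt_graph_section hw (hY y))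
      (fun _ ↦ rfl) (fun _ ↦ rfl) x
    rw [dorfman_graph (contMDiffAt_form_iff.1 (hw x)) (contMDiffAt_vectorField_iff.1 (hX x))
      (contMDiffAt_vectorField_iff.1 (hY x))] at hm
    exact left_eq_add.1 (Eq.symm hm)
  · intro h e₁ e₂ h₁ h₂ m₁ m₂ x
    have r₁ : e₁ = fun y ↦ ((e₁ y).1, contract (w y) (e₁ y).1) :=
      funext fun y ↦ Prod.ext rfl (m₁ y)
    have r₂ : e₂ = fun y ↦ ((e₂ y).1, contract (w y) (e₂ y).1) :=
      funext fun y ↦ Prod.ext rfl (m₂ y)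
    rw [r₁, r₂, dorfman_graph (contMDiffAt_form_iff.1 (hw x)) (contMDiffAt_genTangent_iff.1 (h₁ x)).1
      (contMDiffAt_genTangent_iff.1 (h₂ x)).1, h x]
    exact add_zero _

end HigherDorfman

end
theorem mainTheorem3 {E : Type*} [NormedAddCommGroup E] [NormedSpace ℝ E] [FiniteDimensional ℝ E]
    {M : Type*} [TopologicalSpace M] [T2Space M] [ChartedSpace E M] [IsManifold 𝓘(ℝ, E) ∞ M]
    (n : ℕ) (w : Π x : M, HigherDorfman.Form E (n + 1) x) (hw : HigherDorfman.IsSmoothForm w) :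
    HigherDorfman.IsIsotropicSubbundle (HigherDorfman.formGraph w) ∧
    (1 ≤ n → HigherDorfman.IsMaximalIsotropicSubbundle (HigherDorfman.formGraph w)) ∧
    (HigherDorfman.IsClosedUnderDorfman (HigherDorfman.formGraph w) ↔
      ∀ x, HigherDorfman.extD w x = 0) := by
  refine ⟨⟨HigherDorfman.isSmoothSubbundle_formGraph hw, HigherDorfman.isIsotropic_formGraph w⟩,
    fun hn ↦ ⟨HigherDorfman.isSmoothSubbundle_formGraph hw, ?_⟩,
    HigherDorfman.isClosedUnderDorfman_formGraph_iff hw⟩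
  obtain ⟨n, rfl⟩ := Nat.exists_eq_add_of_le' hn
  exact HigherDorfman.maximal_formGraph w
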